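/- Let $\mathbb{k}$ be an infinite field, let $R=\mathbb{k}[x_1,\dots,x_d]$ be a polynomial ring with its standard grading, and let $\mathfrak m=(x_1,\dots,x_d)$. Let $I\neq 0$ be an ideal of $R$ generated by monomials $f_1,\dots,f_u$ of the same degree $\delta$. Let $\mathcal F=\bigoplus_{n\ge 0} I^n/\mathfrak m I^n$ be the special fiber ring of $I$, let $\mathcal F_+$ be its ideal generated by the elements of positive degree, and let $\ell=\dim \mathcal F$ be the analytic spread of $I$. Let $\underline z=(z_{ij})$, $1\le i\le \ell$, $1\le j\le u$, be variables. Let $J\subseteq R[\underline z]$ be the ideal generated by $b_i=\sum_{j=1}^u z_{ij}f_j$, $1\le i\le \ell$, and let $\mathcal H\subseteq \mathcal F[\underline z]$ be the ideal generated by $\sum_{j=1}^u z_{ij}f_j$, $1\le i\le\ell$, where $f_j$ is here regarded as an element of the degree-one component $I/\mathfrak m I$ of $\mathcal F$. Let $h\in\mathbb{k}[\underline z]$ be a polynomial generating the ideal $$\mathcal A=(\mathcal H:_{\mathcal F[\underline z]}\mathcal F_+^\infty)\cap \mathbb{k}[\underline z],$$ the ideal that defines the locus of those $\underline\lambda\in\mathbb{k}^{\ell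 u}$ for which the specialization of $J$ at $\underline z=\underline\lambda$ is not a reduction of $I$. (It is known that $\mathcal A$ is a prime ideal of height one, so that such an $h$ exists, is irreducible, and is unique up to a nonzero scalar.) Regard $R[\underline z]$ as the polynomial ring $\mathbb{k}[\underline z][x_1,\dots,x_d]$ over $\mathbb{k}[\underline z]$, and let $\operatorname{mono}(J)$ be the ideal of $R[\underline z]$ generated by all elements of $J$ of the form $a\,m$ with $a\in\mathbb{k}[\underline z]$ and $m$ a monomial in $x_1,\dots,x_d$. A subideal $K\subseteq I$ is a reduction of $I$ if $I^{n+1}=KI^n$ for all $n\gg0$, and $\operatorname{gradedcore}(I)$ denotes the intersection of all homogeneous reductions of $I$. Then $$\bigl(\operatorname{mono}(J):_{R[\underline z]}(h)^\infty\bigr)\cap R\subseteq \operatorname{gradedcore}(I).$$ -/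

import Mathlib

noncomputable section

/-! ### Ideals, reductions and the special fiber ring -/

/-- The saturation `L : Q^∞`, i.e. the set of all `x` with `x Qⁿ ⊆ L` for some `n`. -/
def idealSaturation {S : Type*} [CommRing S] (L Q : Ideal S) : Ideal S where
  carrier := {x | ∃ n : ℕ, ∀ q ∈ Q ^ n, x * q ∈ L}
  zero_mem' := ⟨0, fun q _ => by simp⟩
  add_mem' := by
    rintro x y ⟨n, hn⟩ ⟨m, hm⟩
    refine ⟨n + m, fun q hq => ?_⟩
    rw [add_mul]
    exact L.add_mem (hn q (Ideal.pow_le_pow_right (Nat.le_add_right n m) hq))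
      (hm q (Ideal.pow_le_pow_right (Nat.le_add_left m n) hq))
  smul_mem' := by
    rintro c x ⟨n, hn⟩
    refine ⟨n, fun q hq => ?_⟩
    rw [smul_eq_mul, mul_assoc]
    exact L.mul_mem_left c (hn q hq)

/-- The ideal `K` is a reduction of `I`: `K ⊆ I` and `I^(n+1) = K I^n` for all `n ≫ 0`. -/
def IsReductionOf {S : Type*} [CommRing S] (K I : Ideal S) : Prop :=
  K ≤ I ∧ ∃ N : ℕ, ∀ n ≥ N, I ^ (n + 1) = K * I ^ n

/-- The special fiber ring `⊕ₙ Iⁿ / 𝔪 Iⁿ` of `I`, as the quotient of the Rees algebra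
`S[It] = ⊕ₙ Iⁿ tⁿ` by its ideal `𝔪 S[It] = ⊕ₙ 𝔪 Iⁿ tⁿ`. -/
def SpecialFiberRing {S : Type*} [CommRing S] (𝔪 I : Ideal S) : Type _ :=
  reesAlgebra I ⧸ 𝔪.map (algebraMap S (reesAlgebra I))

namespace SpecialFiberRing

instance {S : Type*} [CommRing S] (𝔪 I : Ideal S) : CommRing (SpecialFiberRing 𝔪 I) :=
  inferInstanceAs (CommRing (reesAlgebra I ⧸ 𝔪.map (algebraMap S (reesAlgebra I))))

/-- The projection from the Rees algebra onto the special fiber ring. -/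
def mk {S : Type*} [CommRing S] (𝔪 I : Ideal S) : reesAlgebra I →+* SpecialFiberRing 𝔪 I :=
  Ideal.Quotient.mk (𝔪.map (algebraMap S (reesAlgebra I)))

variable {S : Type*} [CommRing S] (𝔪 : Ideal S) {I : Ideal S}

/-- The class of `x ∈ I` in the degree one component `I / 𝔪 I` of the special fiber ring. -/
def degreeOne (x : I) : SpecialFiberRing 𝔪 I :=
  mk 𝔪 I
    ⟨Polynomial.monomial 1 (x : S), reesAlgebra.monomial_mem.2 (by simp)⟩

variable (I) in
/-- The ideal of the special fiber ring generated by the elements of positive degree. -/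
def irrelevant : Ideal (SpecialFiberRing 𝔪 I) :=
  Ideal.span {y | ∃ p : reesAlgebra I, (p : Polynomial S).coeff 0 = 0 ∧
    mk 𝔪 I p = y}

end SpecialFiberRing

/-! ### Ideals of the polynomial ring `R = 𝕜[x₁, …, x_d]` with its standard grading -/

section PolynomialRing

variable {𝕜 : Type*} [Field 𝕜] {d : ℕ}

/-- The homogeneous maximal ideal `𝔪 = (x₁, …, x_d)` of `R`. -/
def homMax (𝕜 : Type*) [Field 𝕜] (d : ℕ) : Ideal (MvPolynomial (Fin d) 𝕜) :=
  Ideal.span (Set.range MvPolynomial.X)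

/-- The special fiber ring of an ideal `I` of `R`, with respect to `𝔪 = (x₁, …, x_d)`. -/
abbrev Fiber (I : Ideal (MvPolynomial (Fin d) 𝕜)) : Type _ :=
  SpecialFiberRing (homMax 𝕜 d) I

/-- The structure map `𝕜 → R → R[It] → 𝓕` of the special fiber ring `𝓕` of `I`. -/
def fiberScalars (I : Ideal (MvPolynomial (Fin d) 𝕜)) : 𝕜 →+* Fiber I :=
  ((SpecialFiberRing.mk (homMax 𝕜 d) I).comp
    (algebraMap (MvPolynomial (Fin d) 𝕜) (reesAlgebra I))).comp MvPolynomial.C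

/-- The analytic spread of `I`: the Krull dimension of its special fiber ring. -/
def analyticSpread (I : Ideal (MvPolynomial (Fin d) 𝕜)) : WithBot ℕ∞ :=
  ringKrullDim (Fiber I)

attribute [local instance] MvPolynomial.gradedAlgebra in
/-- The graded core of `I`: the intersection of all homogeneous reductions of `I`. -/
def gradedCore (I : Ideal (MvPolynomial (Fin d) 𝕜)) : Ideal (MvPolynomial (Fin d) 𝕜) :=
  sInf {K | K.IsHomogeneous (MvPolynomial.homogeneousSubmodule (Fin d) 𝕜) ∧ IsReductionOf K I}

/-- For an ideal `L` of `A[x₁, …, x_d]`, the ideal generated by the elements of `L` of the form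
`a m` with `a ∈ A` and `m` a monomial in `x₁, …, x_d`. -/
def monoIdeal {A : Type*} [CommRing A] (L : Ideal (MvPolynomial (Fin d) A)) :
    Ideal (MvPolynomial (Fin d) A) :=
  Ideal.span {p | p ∈ L ∧ ∃ (v : Fin d →₀ ℕ) (a : A), p = MvPolynomial.monomial v a}

/-- The coefficient ring `𝕜[z]`, with `z = (z_ij)` an `ℓ × u` matrix of variables. -/
abbrev CoeffRing (𝕜 : Type*) [Field 𝕜] (ℓ u : ℕ) : Type _ := MvPolynomial (Fin ℓ × Fin u) 𝕜

/-- The inclusion of `R = 𝕜[x]` into `R[z]`, the latter written as `𝕜[z][x]`. -/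
def inclR (𝕜 : Type*) [Field 𝕜] (d ℓ u : ℕ) :
    MvPolynomial (Fin d) 𝕜 →+* MvPolynomial (Fin d) (CoeffRing 𝕜 ℓ u) :=
  MvPolynomial.map MvPolynomial.C

/-- The ideal `J` of `R[z] = 𝕜[z][x]` generated by `b_i = ∑ⱼ z_ij f_j`, for `1 ≤ i ≤ ℓ`. -/
def genericIdeal {u : ℕ} (ℓ : ℕ) (f : Fin u → MvPolynomial (Fin d) 𝕜) :
    Ideal (MvPolynomial (Fin d) (CoeffRing 𝕜 ℓ u)) :=
  Ideal.span (Set.range fun i : Fin ℓ =>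
    ∑ j : Fin u, MvPolynomial.C (MvPolynomial.X (i, j)) * inclR 𝕜 d ℓ u (f j))

/-- The ideal `𝓗` of `𝓕[z]`, with `𝓕` the special fiber ring of `I`, generated by
`∑ⱼ z_ij f_j`, for `1 ≤ i ≤ ℓ`, where `f_j` is regarded as an element of degree one of `𝓕`. -/
def genericFiberIdeal {I : Ideal (MvPolynomial (Fin d) 𝕜)} {u : ℕ} (ℓ : ℕ) (f : Fin u → I) :
    Ideal (MvPolynomial (Fin ℓ × Fin u) (Fiber I)) :=
  Ideal.span (Set.range fun i : Fin ℓ =>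
    ∑ j : Fin u, MvPolynomial.X (i, j) * MvPolynomial.C (SpecialFiberRing.degreeOne (homMax 𝕜 d) (f j)))

/-- The ideal `𝓐 = (𝓗 :_{𝓕[z]} 𝓕₊^∞) ∩ 𝕜[z]` of `𝕜[z]`, which defines the locus of those
matrices `λ` for which the specialization of `J` at `z = λ` is not a reduction of `I`. -/
def nonReductionIdeal {I : Ideal (MvPolynomial (Fin d) 𝕜)} {u : ℕ} (ℓ : ℕ) (f : Fin u → I) :
    Ideal (CoeffRing 𝕜 ℓ u) :=
  (idealSaturation (genericFiberIdeal ℓ f)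
    ((SpecialFiberRing.irrelevant (homMax 𝕜 d) I).map MvPolynomial.C)).comap
      (MvPolynomial.map (fiberScalars I))

end PolynomialRing

end

/-!
Write `W` for the `𝕜`-span of the `f_j`, so that `W ^ n` is the component of degree `δ n` of `I ^ n`.

If `x` lies in the left hand side, some `x hⁿ` lies in `J`, and specializing `z` to a matrix `λ` with
`h(λ) ≠ 0` gives `x ∈ J_λ`, the ideal generated by the forms `∑ⱼ λ_ij f_j`. It is therefore enough
that every homogeneous reduction `K` of `I` contains some `J_λ` with `h(λ) ≠ 0`
(`exists_reduction_eval_ne_zero`). This is shown as follows.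

* Comparing components of lowest degree in `I^(n+1) = K I^n` gives `W ^ (n + 1) ≤ U * W ^ n` with
  `U = K ∩ W` (`exists_span_pow_succ_le`).
* The space `U` may be replaced by the span of `ℓ` of its elements (`exists_fin_reduction`). More
  than `ℓ` elements `v_i` of `W` satisfy a nontrivial homogeneous relation
  (`exists_isHomogeneous_aeval_eq_zero`): the ring `𝕜[f_1 t, …, f_u t]` is a quotient of the special
  fiber ring, so its dimension, which bounds its transcendence degree, is at most `ℓ`.
  Since `𝕜` is infinite, a linear change of the `v_i` turns the relation into one that is monic in
  one of them, and that one can be dropped (`exists_eliminate`).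
* If the forms `∑ⱼ λ_ij f_j` satisfy `W ^ (N + 1) ≤ U * W ^ N` for their span `U`, then the degree
  `N + 1` part of `𝓕[z] / 𝓗` is a finitely generated `𝕜[z]`-module that vanishes at `z = λ`, so
  Nakayama's lemma provides an `a ∈ 𝓐` with `a(λ) = 1`
  (`exists_mem_nonReductionIdeal_eval_eq_one`). As `h` divides `a`, also `h(λ) ≠ 0`.
-/

/-! ### Transcendence degree and Krull dimension -/

/-- The transcendence degree is at most the Krull dimension: by Noether normalization `A` is
integral over a polynomial ring in `s ≥ m` variables, and chains of primes lift by going up. -/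
theorem natCast_le_ringKrullDim_of_algebraicIndependent {k A : Type*} [Field k] [CommRing A]
    [IsDomain A] [Algebra k A] [Algebra.FiniteType k A] {m : ℕ} {v : Fin m → A}
    (hv : AlgebraicIndependent k v) : (m : WithBot ℕ∞) ≤ ringKrullDim A := by
  obtain ⟨s, g, hg, hint⟩ := exists_integral_inj_algHom_of_fg k A
  have hms : m ≤ s := by
    have halg : Algebra.IsAlgebraic
        (Algebra.adjoin k (Set.range fun i => g (MvPolynomial.X i))) A := by
      have hr : Algebra.adjoin k (Set.range fun i => g (MvPolynomial.X i)) = g.range := by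
        rw [← Algebra.map_top, ← MvPolynomial.adjoin_range_X, AlgHom.map_adjoin, ← Set.range_comp]
        rfl
      refine ⟨fun x => IsIntegral.isAlgebraic ?_⟩
      obtain ⟨p, hp, hpx⟩ := hint x
      refine ⟨p.map ((Subalgebra.inclusion hr.ge).toRingHom.comp g.rangeRestrict.toRingHom),
        hp.map _, ?_⟩
      rw [Polynomial.eval₂_map]
      exact hpx
    have h1 := hv.lift_cardinalMk_le_trdeg
    have h2 := Cardinal.lift_le.{0}.2 (Algebra.IsAlgebraic.trdeg_le_cardinalMk k
      (Set.range fun i => g (MvPolynomial.X i)))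
    have h3 : Cardinal.mk (Set.range fun i => g (MvPolynomial.X i)) ≤ s := by
      simpa using Cardinal.mk_range_le_lift (f := fun i => g (MvPolynomial.X i))
    have h4 : (m : Cardinal.{0}) ≤ s := by
      have h5 := h2.trans (Cardinal.lift_le.{0}.2 h3)
      simp only [Cardinal.mk_fin, Cardinal.lift_natCast] at h1 h5
      simpa using h1.trans h5
    exact_mod_cast h4
  algebraize [g.toRingHom]
  have hdim : ringKrullDim (MvPolynomial (Fin s) k) = s := by
    simp [MvPolynomial.ringKrullDim_of_isNoetherianRing]
  have : FaithfulSMul (MvPolynomial (Fin s) k) A :=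
    (faithfulSMul_iff_algebraMap_injective _ _).2 hg
  have : Algebra.IsIntegral (MvPolynomial (Fin s) k) A := ⟨hint⟩
  obtain ⟨l, hl⟩ := Order.le_krullDim_iff.1 (hdim.ge : (s : WithBot ℕ∞) ≤ _)
  obtain ⟨⟨Q, hQ, hlo⟩⟩ := Ideal.nonempty_primesOver (S := A) (RelSeries.head l).asIdeal
  obtain ⟨L, hL, -⟩ := Ideal.exists_ltSeries_of_hasGoingUp l Q
  refine le_trans ?_ (Order.LTSeries.length_le_krullDim L)
  rw [hL, hl]
  exact_mod_cast hms

/-! ### Eliminating a generator by a linear change of variables -/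

section Elimination

variable {k A ι : Type*} [Field k] [CommRing A] [Algebra k A]

theorem Submodule.sup_pow_succ_le (U V : Submodule k A) (n : ℕ) :
    (U ⊔ V) ^ (n + 1) ≤ U * (U ⊔ V) ^ n ⊔ V ^ (n + 1) := by
  induction n with
  | zero => simp
  | succ n ih =>
    calc (U ⊔ V) ^ (n + 1 + 1) = U * (U ⊔ V) ^ (n + 1) ⊔ V * (U ⊔ V) ^ (n + 1) := by
          rw [pow_succ' _ (n + 1), Submodule.sup_mul]
      _ ≤ U * (U ⊔ V) ^ (n + 1) ⊔ V * (U * (U ⊔ V) ^ n ⊔ V ^ (n + 1)) := by gcongr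
      _ = U * (U ⊔ V) ^ (n + 1) ⊔ (U * (V * (U ⊔ V) ^ n) ⊔ V ^ (n + 1 + 1)) := by
          rw [Submodule.mul_sup, ← pow_succ', mul_left_comm]
      _ ≤ U * (U ⊔ V) ^ (n + 1) ⊔ V ^ (n + 1 + 1) := by
          rw [← sup_assoc]
          refine sup_le_sup_right (sup_le le_rfl ?_) _
          rw [pow_succ' _ n]
          gcongr
          exact le_sup_right

/-- If `a i ≡ c i • w` modulo `U'` for all `i`, then a monomial of degree `n + 1` takes the same value
at `a` and at `c • w` modulo `U' * U ^ n`. -/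
theorem monomial_sub_smul_pow_mem {U U' : Submodule k A} (hU : U' ≤ U) {a : ι → A} {c : ι → k}
    {w : A} (hw : w ∈ U) (ha : ∀ i, a i - c i • w ∈ U') (n : ℕ) (s : ι →₀ ℕ)
    (hs : s.degree = n + 1) :
    s.prod (fun i e => a i ^ e) - s.prod (fun i e => c i ^ e) • w ^ (n + 1) ∈ U' * U ^ n := by
  classical
  induction n generalizing s with
  | zero =>
    obtain ⟨i, rfl⟩ : s ∈ Set.range (fun i : ι => Finsupp.single i 1) := by
      rw [Finsupp.range_single_one]
      exact hs
    simpa using ha i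
  | succ n ih =>
    obtain ⟨i, hi⟩ : ∃ i, s i ≠ 0 := by
      by_contra! h
      have : s = 0 := Finsupp.ext h
      simp [this] at hs
    obtain ⟨t, rfl⟩ : ∃ t, s = Finsupp.single i 1 + t :=
      ⟨s - Finsupp.single i 1, (add_tsub_cancel_of_le (by
        simpa [Finsupp.single_le_iff] using Nat.one_le_iff_ne_zero.2 hi)).symm⟩
    have ht : t.degree = n + 1 := by simp at hs; omega
    have hi' : a i ∈ U := by
      simpa using U.add_mem (hU (ha i)) (U.smul_mem (c i) hw)
    have hprod {B : Type _} [CommRing B] (b : ι → B) :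
        (Finsupp.single i 1 + t).prod (fun i e => b i ^ e) =
          b i * t.prod (fun i e => b i ^ e) := by
      rw [Finsupp.prod_add_index' (by simp) (by simp [pow_add])]
      simp
    rw [hprod a, Finsupp.prod_add_index' (by simp) (by simp [pow_add])]
    have hexp : a i * t.prod (fun i e => a i ^ e) -
        ((Finsupp.single i 1).prod (fun i e => c i ^ e) * t.prod fun i e => c i ^ e) •
          w ^ (n + 1 + 1) =
        a i * (t.prod (fun i e => a i ^ e) - t.prod (fun i e => c i ^ e) • w ^ (n + 1)) +
        (a i - c i • w) * (t.prod (fun i e => c i ^ e) • w ^ (n + 1)) := by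
      simp [Algebra.smul_def]
      ring
    rw [hexp]
    refine add_mem ?_ (Submodule.mul_mem_mul (ha i) (Submodule.smul_mem _ _
      (Submodule.pow_mem_pow _ hw _)))
    have := Submodule.mul_mem_mul hi' (ih t ht)
    rwa [mul_left_comm, ← pow_succ'] at this

theorem aeval_sub_smul_pow_mem {U U' : Submodule k A} (hU : U' ≤ U) {a : ι → A} {c : ι → k}
    {w : A} (hw : w ∈ U) (ha : ∀ i, a i - c i • w ∈ U') {n : ℕ} {Q : MvPolynomial ι k}
    (hQ : Q.IsHomogeneous (n + 1)) :
    MvPolynomial.aeval a Q - MvPolynomial.eval c Q • w ^ (n + 1) ∈ U' * U ^ n := by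
  rw [MvPolynomial.aeval_def, MvPolynomial.eval₂_eq, MvPolynomial.eval_eq, Finset.sum_smul,
    ← Finset.sum_sub_distrib]
  refine Submodule.sum_mem _ fun s hs => ?_
  have hdeg : s.degree = n + 1 := by
    by_contra h
    exact MvPolynomial.mem_support_iff.1 hs (hQ.coeff_eq_zero h)
  have := Submodule.smul_mem _ (Q.coeff s) (monomial_sub_smul_pow_mem hU hw ha n s hdeg)
  rwa [smul_sub, smul_smul, Algebra.smul_def] at this

/-- If `W ^ (N + 1) ≤ span v * W ^ N` and the `v i` satisfy a nontrivial homogeneous relation, then the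
same holds, for larger `N`, with one generator less: with `w = v 0 / c 0`, where `c` is not a zero of the relation, the elements
`v i - c i • w` suffice. -/
theorem exists_eliminate [Infinite k] {W : Submodule k A} {m : ℕ} {v : Fin (m + 1) → A}
    (hv : ∀ i, v i ∈ W) {N : ℕ} (hN : W ^ (N + 1) ≤ Submodule.span k (Set.range v) * W ^ N)
    {n : ℕ} {Q : MvPolynomial (Fin (m + 1)) k} (hQ : Q.IsHomogeneous n) (hQ0 : Q ≠ 0)
    (hQv : MvPolynomial.aeval v Q = 0) :
    ∃ u : Fin m → A, (∀ i, u i ∈ Submodule.span k (Set.range v)) ∧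
      ∃ N', W ^ (N' + 1) ≤ Submodule.span k (Set.range u) * W ^ N' := by
  -- Multiplying by `X 0` forces the first coordinate of a non-root to be nonzero.
  have hQX : (Q * MvPolynomial.X 0).IsHomogeneous (n + 1) :=
    hQ.mul (MvPolynomial.isHomogeneous_X _ _)
  obtain ⟨c, hc⟩ : ∃ c, MvPolynomial.eval c (Q * MvPolynomial.X 0) ≠ 0 := by
    by_contra! h
    exact mul_ne_zero hQ0 (MvPolynomial.X_ne_zero 0) (hQX.eq_zero_of_forall_eval_eq_zero h)
  have hc0 : c 0 ≠ 0 := by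
    rintro h
    simp [h] at hc
  set U := Submodule.span k (Set.range v)
  have hvU (i) : v i ∈ U := Submodule.subset_span ⟨i, rfl⟩
  set w := (c 0)⁻¹ • v 0 with hw
  have hwU : w ∈ U := U.smul_mem _ (hvU 0)
  let u : Fin m → A := fun i => v i.succ - c i.succ • w
  have hu (i) : u i ∈ U := U.sub_mem (hvU _) (U.smul_mem _ hwU)
  set U' := Submodule.span k (Set.range u)
  have hU' : U' ≤ U := Submodule.span_le.2 (by rintro _ ⟨i, rfl⟩; exact hu i)
  have ha (i) : v i - c i • w ∈ U' := by
    refine Fin.cases ?_ (fun i => ?_) i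
    · simp [hw, smul_smul, hc0]
    · exact Submodule.subset_span ⟨i, rfl⟩
  have hwn : w ^ (n + 1) ∈ U' * U ^ n := by
    have := aeval_sub_smul_pow_mem hU' hwU ha hQX
    rw [map_mul, hQv, zero_mul, zero_sub, Submodule.neg_mem_iff] at this
    exact (Submodule.smul_mem_iff _ hc).1 this
  have hUsup : U = U' ⊔ Submodule.span k {w} := by
    refine le_antisymm (Submodule.span_le.2 ?_) (sup_le hU' (by simpa using hwU))
    rintro _ ⟨i, rfl⟩
    rw [← sub_add_cancel (v i) (c i • w)]
    exact Submodule.add_mem_sup (ha i)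
      (Submodule.smul_mem _ _ (Submodule.mem_span_singleton_self w))
  have hUn : U ^ (n + 1) ≤ U' * U ^ n := by
    have := Submodule.sup_pow_succ_le U' (Submodule.span k {w}) n
    rw [← hUsup, Submodule.span_pow {w}, Set.singleton_pow] at this
    exact this.trans (sup_le le_rfl (by simpa using hwn))
  have hUW : U ≤ W := Submodule.span_le.2 (by rintro _ ⟨i, rfl⟩; exact hv i)
  have hpow (j : ℕ) : W ^ (N + j) ≤ U ^ j * W ^ N := by
    induction j with
    | zero => simp
    | succ j ih =>
      calc W ^ (N + (j + 1)) = W ^ (N + j) * W := by rw [← add_assoc, pow_succ]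
        _ ≤ U ^ j * W ^ N * W := by gcongr
        _ = U ^ j * W ^ (N + 1) := by rw [pow_succ, mul_assoc]
        _ ≤ U ^ j * (U * W ^ N) := by gcongr
        _ = U ^ (j + 1) * W ^ N := by rw [pow_succ, mul_assoc]
  refine ⟨u, hu, n + N, ?_⟩
  calc W ^ (n + N + 1) = W ^ (N + (n + 1)) := by congr 1; ring
    _ ≤ U ^ (n + 1) * W ^ N := hpow _
    _ ≤ U' * U ^ n * W ^ N := by gcongr
    _ ≤ U' * W ^ n * W ^ N := by gcongr
    _ = U' * W ^ (n + N) := by rw [mul_assoc, pow_add]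

/-- If any more than `ℓ` elements of `W` satisfy a nontrivial homogeneous relation, then every
finitely spanned `U ≤ W` with `W ^ (N + 1) ≤ U * W ^ N` contains a subspace spanned by `ℓ` elements
with the same property, for larger `N`. -/
theorem exists_fin_reduction [Infinite k] {W : Submodule k A} {ℓ : ℕ}
    (hdep : ∀ m : ℕ, ℓ < m → ∀ v : Fin m → A, (∀ i, v i ∈ W) → ∃ n, ∃ Q : MvPolynomial (Fin m) k,
      Q.IsHomogeneous n ∧ Q ≠ 0 ∧ MvPolynomial.aeval v Q = 0)
    {m : ℕ} {v : Fin m → A} (hv : ∀ i, v i ∈ W) {N : ℕ}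
    (hN : W ^ (N + 1) ≤ Submodule.span k (Set.range v) * W ^ N) :
    ∃ u : Fin ℓ → A, (∀ i, u i ∈ Submodule.span k (Set.range v)) ∧
      ∃ N', W ^ (N' + 1) ≤ Submodule.span k (Set.range u) * W ^ N' := by
  induction m generalizing N with
  | zero =>
    refine ⟨0, fun i => Submodule.zero_mem _, N, hN.trans ?_⟩
    simp
  | succ m ih =>
    by_cases h : ℓ < m + 1
    · obtain ⟨n, Q, hQ, hQ0, hQv⟩ := hdep _ h v hv
      obtain ⟨u, hu, N', hN'⟩ := exists_eliminate hv hN hQ hQ0 hQv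
      have hspan {x} (hx : x ∈ Submodule.span k (Set.range u)) :
          x ∈ Submodule.span k (Set.range v) :=
        Submodule.span_le.2 (by rintro _ ⟨i, rfl⟩; exact hu i) hx
      obtain ⟨u', hu', hN''⟩ := ih (fun i => Submodule.span_le.2
        (by rintro _ ⟨i, rfl⟩; exact hv i) (hu i)) hN'
      exact ⟨u', fun i => hspan (hu' i), hN''⟩
    · obtain ⟨e, rfl⟩ := Nat.exists_eq_add_of_le (not_lt.1 h)
      refine ⟨Fin.append v 0, fun i => ?_, N, hN.trans ?_⟩
      · refine Fin.addCases (fun j => ?_) (fun j => ?_) i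
        · rw [Fin.append_left]
          exact Submodule.subset_span ⟨j, rfl⟩
        · simp [Fin.append_right]
      · gcongr
        rintro _ ⟨j, rfl⟩
        exact ⟨Fin.castAdd e j, Fin.append_left _ _ _⟩

end Elimination

/-! ### Initial degrees -/

section InitialDegree

variable {𝕜 : Type*} [Field 𝕜] {d : ℕ}

theorem mem_homMax_pow_iff {n : ℕ} {p : MvPolynomial (Fin d) 𝕜} :
    p ∈ homMax 𝕜 d ^ n ↔ ∀ s ∈ p.support, n ≤ s.degree :=
  MvPolynomial.mem_pow_idealOfVars_iff n p

theorem MvPolynomial.IsHomogeneous.mem_homMax_pow {n : ℕ} {p : MvPolynomial (Fin d) 𝕜}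
    (hp : p.IsHomogeneous n) : p ∈ homMax 𝕜 d ^ n := by
  refine mem_homMax_pow_iff.2 fun s hs => ?_
  by_contra! h
  exact MvPolynomial.mem_support_iff.1 hs (hp.coeff_eq_zero h.ne)

theorem homogeneousComponent_eq_zero_of_mem_homMax_pow {n : ℕ} {p : MvPolynomial (Fin d) 𝕜}
    (hp : p ∈ homMax 𝕜 d ^ (n + 1)) : MvPolynomial.homogeneousComponent n p = 0 := by
  refine MvPolynomial.homogeneousComponent_eq_zero' _ _ fun s hs => ?_
  have := mem_homMax_pow_iff.1 hp s hs
  omega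

theorem sub_homogeneousComponent_mem_homMax_pow {n : ℕ} {p : MvPolynomial (Fin d) 𝕜}
    (hp : p ∈ homMax 𝕜 d ^ n) :
    p - MvPolynomial.homogeneousComponent n p ∈ homMax 𝕜 d ^ (n + 1) := by
  refine mem_homMax_pow_iff.2 fun s hs => ?_
  rw [MvPolynomial.mem_support_iff, MvPolynomial.coeff_sub,
    MvPolynomial.coeff_homogeneousComponent] at hs
  split_ifs at hs with h
  · simp at hs
  · rw [sub_zero] at hs
    have := mem_homMax_pow_iff.1 hp s (MvPolynomial.mem_support_iff.2 hs)
    omega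

/-- Initial forms multiply: terms of degree above `a` in `p` or above `b` in `q` contribute only to
degrees above `a + b` of `p * q`. -/
theorem homogeneousComponent_mul_of_mem_homMax_pow {a b : ℕ} {p q : MvPolynomial (Fin d) 𝕜}
    (hp : p ∈ homMax 𝕜 d ^ a) (hq : q ∈ homMax 𝕜 d ^ b) :
    MvPolynomial.homogeneousComponent (a + b) (p * q) =
      MvPolynomial.homogeneousComponent a p * MvPolynomial.homogeneousComponent b q := by
  set p' := MvPolynomial.homogeneousComponent a p with hp'
  set q' := MvPolynomial.homogeneousComponent b q with hq'
  have hp'h : p'.IsHomogeneous a := MvPolynomial.homogeneousComponent_isHomogeneous _ _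
  have hq'h : q'.IsHomogeneous b := MvPolynomial.homogeneousComponent_isHomogeneous _ _
  have h1 : (p - p') * q ∈ homMax 𝕜 d ^ (a + b + 1) := by
    rw [show a + b + 1 = (a + 1) + b by ring, pow_add]
    exact Ideal.mul_mem_mul (sub_homogeneousComponent_mem_homMax_pow hp) hq
  have h2 : p' * (q - q') ∈ homMax 𝕜 d ^ (a + b + 1) := by
    rw [add_assoc, pow_add]
    exact Ideal.mul_mem_mul hp'h.mem_homMax_pow (sub_homogeneousComponent_mem_homMax_pow hq)
  rw [show p * q = p' * q' + ((p - p') * q + p' * (q - q')) by ring, map_add,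
    homogeneousComponent_eq_zero_of_mem_homMax_pow (Ideal.add_mem _ h1 h2), add_zero,
    MvPolynomial.homogeneousComponent_eq_self (hp'h.mul hq'h)]

variable {u δ : ℕ} {f : Fin u → MvPolynomial (Fin d) 𝕜}

theorem span_le_homMax_pow (hf : ∀ j, (f j).IsHomogeneous δ) :
    Ideal.span (Set.range f) ≤ homMax 𝕜 d ^ δ := by
  refine Ideal.span_le.2 ?_
  rintro _ ⟨j, rfl⟩
  exact (hf j).mem_homMax_pow

theorem span_pow_le_homMax_pow (hf : ∀ j, (f j).IsHomogeneous δ) (n : ℕ) :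
    Ideal.span (Set.range f) ^ n ≤ homMax 𝕜 d ^ (δ * n) := by
  rw [pow_mul]
  exact Ideal.pow_right_mono (span_le_homMax_pow hf) n

theorem homogeneousComponent_mem_span (hf : ∀ j, (f j).IsHomogeneous δ)
    {p : MvPolynomial (Fin d) 𝕜} (hp : p ∈ Ideal.span (Set.range f)) :
    MvPolynomial.homogeneousComponent δ p ∈ Submodule.span 𝕜 (Set.range f) := by
  obtain ⟨c, rfl⟩ := Ideal.mem_span_range_iff_exists_fun.1 hp
  rw [map_sum]
  refine Submodule.sum_mem _ fun j _ => ?_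
  have := homogeneousComponent_mul_of_mem_homMax_pow (a := 0) (b := δ) (p := c j) (q := f j)
    (by simp) (hf j).mem_homMax_pow
  rw [zero_add] at this
  rw [this, MvPolynomial.homogeneousComponent_eq_self (hf j),
    MvPolynomial.homogeneousComponent_zero, ← MvPolynomial.smul_eq_C_mul]
  exact Submodule.smul_mem _ _ (Submodule.subset_span ⟨j, rfl⟩)

theorem homogeneousComponent_mem_span_pow (hf : ∀ j, (f j).IsHomogeneous δ) (n : ℕ)
    {p : MvPolynomial (Fin d) 𝕜} (hp : p ∈ Ideal.span (Set.range f) ^ n) :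
    MvPolynomial.homogeneousComponent (δ * n) p ∈ Submodule.span 𝕜 (Set.range f) ^ n := by
  induction n generalizing p with
  | zero =>
    rw [mul_zero, MvPolynomial.homogeneousComponent_zero, pow_zero]
    exact Submodule.mem_one.2 ⟨_, rfl⟩
  | succ n ih =>
    rw [pow_succ] at hp
    refine Submodule.mul_induction_on hp (fun x hx y hy => ?_) (fun x y hx hy => ?_)
    · rw [mul_add, mul_one, homogeneousComponent_mul_of_mem_homMax_pow
        (span_pow_le_homMax_pow hf n hx) (span_le_homMax_pow hf hy), pow_succ]
      exact Submodule.mul_mem_mul (ih hx) (homogeneousComponent_mem_span hf hy)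
    · rw [map_add]
      exact add_mem hx hy

theorem span_pow_isHomogeneous (hf : ∀ j, (f j).IsHomogeneous δ) (n : ℕ)
    {p : MvPolynomial (Fin d) 𝕜} (hp : p ∈ Submodule.span 𝕜 (Set.range f) ^ n) :
    p.IsHomogeneous (δ * n) := by
  induction n generalizing p with
  | zero =>
    rw [pow_zero, Submodule.mem_one] at hp
    obtain ⟨c, rfl⟩ := hp
    exact MvPolynomial.isHomogeneous_C _ _
  | succ n ih =>
    rw [pow_succ] at hp
    refine Submodule.mul_induction_on hp (fun x hx y hy => ?_) (fun x y hx hy => hx.add hy)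
    have h1 : Submodule.span 𝕜 (Set.range f) ≤ MvPolynomial.homogeneousSubmodule (Fin d) 𝕜 δ :=
      Submodule.span_le.2 (by rintro _ ⟨j, rfl⟩; exact hf j)
    exact (ih hx).mul (h1 hy)

theorem span_pow_le_ideal_span_pow (n : ℕ) {p : MvPolynomial (Fin d) 𝕜}
    (hp : p ∈ Submodule.span 𝕜 (Set.range f) ^ n) : p ∈ Ideal.span (Set.range f) ^ n := by
  induction n generalizing p with
  | zero => simp
  | succ n ih =>
    rw [pow_succ] at hp ⊢
    refine Submodule.mul_induction_on hp (fun x hx y hy => Ideal.mul_mem_mul (ih hx) ?_)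
      (fun x y hx hy => add_mem hx hy)
    exact Submodule.span_le_restrictScalars 𝕜 (MvPolynomial (Fin d) 𝕜) (Set.range f) hy

attribute [local instance] MvPolynomial.gradedAlgebra in
/-- The degree `δ` part of a homogeneous reduction of an ideal generated in degree `δ` already
satisfies the reduction equation on the spaces of generators. -/
theorem exists_span_pow_succ_le (hf : ∀ j, (f j).IsHomogeneous δ)
    {K : Ideal (MvPolynomial (Fin d) 𝕜)}
    (hK : K.IsHomogeneous (MvPolynomial.homogeneousSubmodule (Fin d) 𝕜))
    (hred : IsReductionOf K (Ideal.span (Set.range f))) :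
    ∃ N, Submodule.span 𝕜 (Set.range f) ^ (N + 1) ≤
      (K.restrictScalars 𝕜 ⊓ Submodule.span 𝕜 (Set.range f)) *
        Submodule.span 𝕜 (Set.range f) ^ N := by
  obtain ⟨hKI, N, hN⟩ := hred
  refine ⟨N, fun p hp => ?_⟩
  have hp' : p ∈ K * Ideal.span (Set.range f) ^ N := hN N le_rfl ▸ span_pow_le_ideal_span_pow _ hp
  rw [← MvPolynomial.homogeneousComponent_eq_self (span_pow_isHomogeneous hf _ hp)]
  refine Submodule.mul_induction_on hp' (fun x hx y hy => ?_) (fun x y hx hy => ?_)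
  · rw [mul_add, mul_one, add_comm, homogeneousComponent_mul_of_mem_homMax_pow
      (span_le_homMax_pow hf (hKI hx)) (span_pow_le_homMax_pow hf N hy)]
    refine Submodule.mul_mem_mul ⟨?_, homogeneousComponent_mem_span hf (hKI hx)⟩
      (homogeneousComponent_mem_span_pow hf N hy)
    exact MvPolynomial.homogeneousComponent_mem_of_mem hK hx δ
  · rw [map_add]
    exact add_mem hx hy

end InitialDegree

/-! ### The special fiber ring -/

noncomputable section

open Polynomial in
/-- The coefficient of `tⁿ` in `P(v₁ t, v₂ t, …)` is `Pₙ(v₁, v₂, …)`, with `Pₙ` the degree `n` part of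
`P`. -/
theorem coeff_aeval_monomial_one {k A ι : Type*} [Field k] [CommRing A] [Algebra k A]
    (v : ι → A) (P : MvPolynomial ι k) (n : ℕ) :
    (MvPolynomial.aeval (fun i => (monomial 1 (v i) : A[X])) P).coeff n =
      MvPolynomial.aeval v (MvPolynomial.homogeneousComponent n P) := by
  induction P using MvPolynomial.induction_on' with
  | add p q hp hq => simp [hp, hq]
  | monomial s a =>
    have h1 : MvPolynomial.aeval (fun i => (monomial 1 (v i) : A[X]))
        (MvPolynomial.monomial s a) =
        monomial s.degree (MvPolynomial.aeval v (MvPolynomial.monomial s a)) := by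
      rw [MvPolynomial.aeval_monomial, MvPolynomial.aeval_monomial]
      have : s.prod (fun i e => (monomial 1 (v i) : A[X]) ^ e) =
          monomial s.degree (s.prod fun i e => v i ^ e) := by
        simp only [Finsupp.prod, monomial_pow, one_mul, Finsupp.degree_apply]
        induction s.support using Finset.cons_induction with
        | empty => simp
        | cons i t hi ih => rw [Finset.prod_cons, Finset.prod_cons, Finset.sum_cons, ih,
            monomial_mul_monomial]
      rw [this, IsScalarTower.algebraMap_apply k A A[X], algebraMap_eq, C_mul_monomial]
    rw [h1, coeff_monomial, MvPolynomial.homogeneousComponent_of_mem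
      (MvPolynomial.isHomogeneous_monomial a rfl)]
    by_cases h : s.degree = n
    · simp [h]
    · simp [h, Ne.symm h]

/-- The element `x t` of the Rees algebra `S[It]`, for `x ∈ I`. -/
def reesDegreeOne {S : Type*} [CommRing S] {I : Ideal S} (x : I) : reesAlgebra I :=
  ⟨Polynomial.monomial 1 (x : S), reesAlgebra.monomial_mem.2 (by simp)⟩

theorem adjoin_range_reesDegreeOne {S ι : Type*} [CommRing S] {I : Ideal S} {f : ι → I}
    (hspan : Ideal.span (Set.range fun j => (f j : S)) = I) :
    Algebra.adjoin S (Set.range fun j => reesDegreeOne (f j)) = ⊤ := by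
  refine Subalgebra.map_injective (f := (reesAlgebra I).val) Subtype.val_injective ?_
  have hI : Algebra.adjoin S (Set.range fun j => (Polynomial.monomial 1 (f j : S))) =
      reesAlgebra I := by
    rw [← adjoin_monomial_eq_reesAlgebra]
    conv_rhs => rw [← hspan, Ideal.span, Submodule.map_span, Algebra.adjoin_span]
    rw [← Set.range_comp]
    rfl
  rw [AlgHom.map_adjoin, Algebra.map_top, Subalgebra.range_val, ← Set.range_comp]
  exact hI

/-- The special fiber ring is generated in degree one over its degree zero part. -/
theorem irrelevant_le_span {S ι : Type*} [CommRing S] (𝔪 : Ideal S) {I : Ideal S} {f : ι → I}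
    (hspan : Ideal.span (Set.range fun j => (f j : S)) = I) :
    SpecialFiberRing.irrelevant 𝔪 I ≤
      Ideal.span (Set.range fun j => SpecialFiberRing.mk 𝔪 I (reesDegreeOne (f j))) := by
  have key (p : reesAlgebra I) :
      p - algebraMap S (reesAlgebra I) ((p : Polynomial S).coeff 0) ∈
        Ideal.span (Set.range fun j => reesDegreeOne (f j)) := by
    have hp : p ∈ Algebra.adjoin S (Set.range fun j => reesDegreeOne (f j)) := by
      rw [adjoin_range_reesDegreeOne hspan]; trivial
    induction hp using Algebra.adjoin_induction with
    | mem x hx =>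
      obtain ⟨j, rfl⟩ := hx
      have : (((reesDegreeOne (f j) : reesAlgebra I) : Polynomial S)).coeff 0 = 0 := by
        simp [reesDegreeOne, Polynomial.coeff_monomial]
      rw [this, map_zero, sub_zero]
      exact Ideal.subset_span ⟨j, rfl⟩
    | algebraMap r => simp
    | add x y _ _ hx hy =>
      have : ((x + y : reesAlgebra I) : Polynomial S).coeff 0 =
          (x : Polynomial S).coeff 0 + (y : Polynomial S).coeff 0 := by simp
      rw [this, map_add, add_sub_add_comm]
      exact add_mem hx hy
    | mul x y _ _ hx hy =>
      have : ((x * y : reesAlgebra I) : Polynomial S).coeff 0 =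
          (x : Polynomial S).coeff 0 * (y : Polynomial S).coeff 0 := by
        simp [Polynomial.mul_coeff_zero]
      rw [this, map_mul]
      set a := algebraMap S (reesAlgebra I) ((x : Polynomial S).coeff 0)
      set b := algebraMap S (reesAlgebra I) ((y : Polynomial S).coeff 0)
      rw [show x * y - a * b = (x - a) * y + a * (y - b) by ring]
      exact add_mem (Ideal.mul_mem_right _ _ hx) (Ideal.mul_mem_left _ _ hy)
  refine Ideal.span_le.2 ?_
  rintro _ ⟨p, hp, rfl⟩
  have := Ideal.mem_map_of_mem (SpecialFiberRing.mk 𝔪 I) (key p)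
  rw [Ideal.map_span, ← Set.range_comp, hp, map_zero, sub_zero] at this
  exact this

theorem coeff_mem_mul_pow_of_mk_eq_zero {S : Type*} [CommRing S] (𝔪 I : Ideal S)
    {p : reesAlgebra I} (hp : SpecialFiberRing.mk 𝔪 I p = 0) (n : ℕ) :
    (p : Polynomial S).coeff n ∈ 𝔪 * I ^ n := by
  have hp' : p ∈ 𝔪.map (algebraMap S (reesAlgebra I)) := Ideal.Quotient.eq_zero_iff_mem.1 hp
  clear hp
  induction hp' using Submodule.span_induction generalizing n with
  | mem x hx =>
    obtain ⟨s, hs, rfl⟩ := hx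
    change (Polynomial.C s).coeff n ∈ _
    rw [Polynomial.coeff_C]
    split_ifs with h
    · simpa [h] using hs
    · exact zero_mem _
  | zero => exact zero_mem _
  | add x y _ _ hx hy => exact add_mem (hx n) (hy n)
  | smul a x _ hx =>
    change ((a : Polynomial S) * (x : Polynomial S)).coeff n ∈ _
    rw [Polynomial.coeff_mul]
    refine Ideal.sum_mem _ fun ij hij => ?_
    have := Ideal.mul_mem_mul (a.2 ij.1) (hx ij.2)
    rwa [mul_left_comm, ← pow_add, Finset.HasAntidiagonal.mem_antidiagonal.1 hij] at this

variable {𝕜 : Type*} [Field 𝕜] {d u δ : ℕ}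

/-- The presentation `𝕜[T₁, …, T_u] → 𝓕`, `T_j ↦ f_j`, of the special fiber ring. -/
def fiberPresentation {I : Ideal (MvPolynomial (Fin d) 𝕜)} (f : Fin u → I) :
    MvPolynomial (Fin u) 𝕜 →+* Fiber I :=
  (SpecialFiberRing.mk (homMax 𝕜 d) I).comp
    (MvPolynomial.aeval (R := 𝕜) fun j => reesDegreeOne (f j)).toRingHom

theorem fiberPresentation_surjective {I : Ideal (MvPolynomial (Fin d) 𝕜)} {f : Fin u → I}
    (hspan : Ideal.span (Set.range fun j => (f j : MvPolynomial (Fin d) 𝕜)) = I) :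
    Function.Surjective (fiberPresentation f) := by
  intro y
  obtain ⟨p, rfl⟩ := Ideal.Quotient.mk_surjective y
  change ∃ a, _ = SpecialFiberRing.mk (homMax 𝕜 d) I p
  have hp : p ∈ Algebra.adjoin (MvPolynomial (Fin d) 𝕜)
      (Set.range fun j => reesDegreeOne (f j)) := by
    rw [adjoin_range_reesDegreeOne hspan]; trivial
  induction hp using Algebra.adjoin_induction with
  | mem x hx =>
    obtain ⟨j, rfl⟩ := hx
    exact ⟨MvPolynomial.X j, by simp [fiberPresentation]⟩
  | algebraMap r =>
    refine ⟨MvPolynomial.C (MvPolynomial.coeff 0 r), ?_⟩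
    have hr : r - MvPolynomial.C (MvPolynomial.coeff 0 r) ∈ homMax 𝕜 d := by
      have := sub_homogeneousComponent_mem_homMax_pow (n := 0) (p := r) (by simp)
      simpa using this
    have h0 : SpecialFiberRing.mk (homMax 𝕜 d) I (algebraMap _ _
        (r - MvPolynomial.C (MvPolynomial.coeff 0 r))) = 0 :=
      Ideal.Quotient.eq_zero_iff_mem.2 (Ideal.mem_map_of_mem _ hr)
    rw [map_sub, map_sub, sub_eq_zero] at h0
    rw [h0, fiberPresentation, RingHom.comp_apply]
    congr 1
    exact MvPolynomial.aeval_C _ _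
  | add x y _ _ hx hy =>
    obtain ⟨a, ha⟩ := hx
    obtain ⟨b, hb⟩ := hy
    exact ⟨a + b, by rw [map_add, map_add, ha, hb]⟩
  | mul x y _ _ hx hy =>
    obtain ⟨a, ha⟩ := hx
    obtain ⟨b, hb⟩ := hy
    exact ⟨a * b, by rw [map_mul, map_mul, ha, hb]⟩

open Polynomial in
/-- Relations between the `f_j` in the special fiber ring are relations between the `f_j t`: a relation
of degree `n` takes a value in `𝔪 Iⁿ`, which has no nonzero elements of degree `δ n`. -/
theorem aeval_monomial_one_eq_zero_of_fiberPresentation_eq_zero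
    {I : Ideal (MvPolynomial (Fin d) 𝕜)} {f : Fin u → I}
    (hspan : Ideal.span (Set.range fun j => (f j : MvPolynomial (Fin d) 𝕜)) = I)
    (hdeg : ∀ j, (f j : MvPolynomial (Fin d) 𝕜).IsHomogeneous δ)
    {P : MvPolynomial (Fin u) 𝕜} (hP : fiberPresentation f P = 0) :
    MvPolynomial.aeval (fun j => (monomial 1 (f j : MvPolynomial (Fin d) 𝕜) : _[X])) P = 0 := by
  ext1 n
  have h1 := coeff_mem_mul_pow_of_mk_eq_zero _ _ hP n
  have h2 : ((reesAlgebra I).val.restrictScalars 𝕜).comp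
      (MvPolynomial.aeval (R := 𝕜) fun j => reesDegreeOne (f j)) =
      MvPolynomial.aeval (fun j => (monomial 1 (f j : MvPolynomial (Fin d) 𝕜) : _[X])) := by
    refine MvPolynomial.algHom_ext fun j => ?_
    rw [AlgHom.comp_apply, MvPolynomial.aeval_X, MvPolynomial.aeval_X]
    rfl
  replace h1 : (MvPolynomial.aeval
      (fun j => (monomial 1 (f j : MvPolynomial (Fin d) 𝕜) : _[X])) P).coeff n ∈
      homMax 𝕜 d * I ^ n := by
    rw [← h2]
    exact h1
  rw [coeff_aeval_monomial_one] at h1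
  rw [coeff_aeval_monomial_one, coeff_zero]
  have h3 : homMax 𝕜 d * I ^ n ≤ homMax 𝕜 d ^ (δ * n + 1) := by
    rw [pow_succ', ← hspan]
    exact Ideal.mul_mono_right (span_pow_le_homMax_pow hdeg n)
  have h4 := MvPolynomial.IsHomogeneous.aeval
    (MvPolynomial.homogeneousComponent_isHomogeneous n P)
    (fun j => (f j : MvPolynomial (Fin d) 𝕜)) hdeg
  rw [← MvPolynomial.homogeneousComponent_eq_self h4,
    homogeneousComponent_eq_zero_of_mem_homMax_pow (h3 h1)]

/-- More than `dim 𝓕` linear combinations of the `f_j` satisfy a nontrivial homogeneous relation. -/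
theorem exists_isHomogeneous_aeval_eq_zero {I : Ideal (MvPolynomial (Fin d) 𝕜)} {f : Fin u → I}
    (hspan : Ideal.span (Set.range fun j => (f j : MvPolynomial (Fin d) 𝕜)) = I)
    (hdeg : ∀ j, (f j : MvPolynomial (Fin d) 𝕜).IsHomogeneous δ)
    {ℓ : ℕ} (hℓ : analyticSpread I = ℓ) {m : ℕ} (hm : ℓ < m)
    {v : Fin m → MvPolynomial (Fin d) 𝕜}
    (hv : ∀ i, v i ∈ Submodule.span 𝕜 (Set.range fun j => (f j : MvPolynomial (Fin d) 𝕜))) :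
    ∃ n, ∃ Q : MvPolynomial (Fin m) 𝕜,
      Q.IsHomogeneous n ∧ Q ≠ 0 ∧ MvPolynomial.aeval v Q = 0 := by
  by_contra! hcon
  let ft : Fin u → Polynomial (MvPolynomial (Fin d) 𝕜) := fun j => Polynomial.monomial 1 (f j).1
  let ψ : MvPolynomial (Fin u) 𝕜 →ₐ[𝕜] Polynomial (MvPolynomial (Fin d) 𝕜) :=
    MvPolynomial.aeval ft
  have hdim : ringKrullDim ψ.range ≤ ringKrullDim (Fiber I) := by
    let g := Ideal.Quotient.lift (RingHom.ker (fiberPresentation f)) ψ.rangeRestrict.toRingHom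
      (fun P hP => Subtype.ext
        (aeval_monomial_one_eq_zero_of_fiberPresentation_eq_zero hspan hdeg hP))
    have hg : Function.Surjective g :=
      Ideal.Quotient.lift_surjective_of_surjective _ _ ψ.rangeRestrict_surjective
    refine (ringKrullDim_le_of_surjective g hg).trans_eq ?_
    exact ringKrullDim_eq_of_ringEquiv
      (RingHom.quotientKerEquivOfSurjective (fiberPresentation_surjective hspan))
  have hvt (i) : Polynomial.monomial 1 (v i) ∈ ψ.range := by
    obtain ⟨c, hc⟩ := (Submodule.mem_span_range_iff_exists_fun 𝕜).1 (hv i)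
    refine ⟨∑ j, c j • MvPolynomial.X j, ?_⟩
    rw [AlgHom.toRingHom_eq_coe, RingHom.coe_coe, map_sum, ← hc, map_sum]
    refine Finset.sum_congr rfl fun j _ => ?_
    rw [map_smul, MvPolynomial.aeval_X, Polynomial.smul_monomial]
  have hind : AlgebraicIndependent 𝕜
      (fun i => (⟨Polynomial.monomial 1 (v i), hvt i⟩ : ψ.range)) := by
    refine AlgebraicIndependent.of_comp ψ.range.val ?_
    refine (injective_iff_map_eq_zero _).2 fun P hP => ?_
    by_contra hP0
    have hcomp (n) : MvPolynomial.homogeneousComponent n P = 0 := by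
      by_contra h
      refine hcon n _ (MvPolynomial.homogeneousComponent_isHomogeneous n P) h ?_
      rw [← coeff_aeval_monomial_one]
      exact congrArg (Polynomial.coeff · n) hP
    refine hP0 ?_
    rw [← MvPolynomial.sum_homogeneousComponent P]
    exact Finset.sum_eq_zero fun n _ => hcomp n
  have : Algebra.FiniteType 𝕜 ψ.range :=
    Algebra.FiniteType.of_surjective ψ.rangeRestrict ψ.rangeRestrict_surjective
  have h1 := (natCast_le_ringKrullDim_of_algebraicIndependent hind).trans hdim
  rw [show ringKrullDim (Fiber I) = ℓ from hℓ] at h1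
  have : m ≤ ℓ := by exact_mod_cast h1
  omega

end

/-! ### Nakayama over the parameter space -/

/-- Nakayama's lemma at the point `lam` of the parameter space: if the forms `∑ⱼ lam i j • g j` generate
all products of `N + 1` of the `g j`, then these products are killed in any `k[z]`-algebra
`M` in which the generic forms `∑ⱼ z_ij g_j` vanish, by a polynomial that is `1` at `lam`. -/
theorem exists_eval_eq_one_mul_eq_zero {k S M : Type*} [Field k] [CommRing S] [Algebra k S]
    [CommRing M] {ℓ u : ℕ} (θ : S →+* M) (η : CoeffRing k ℓ u →+* M)
    (hθη : ∀ c, θ (algebraMap k S c) = η (MvPolynomial.C c)) (g : Fin u → S)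
    (hg : ∀ i, ∑ j, η (MvPolynomial.X (i, j)) * θ (g j) = 0) (lam : Fin ℓ → Fin u → k) {N : ℕ}
    (hN : Submodule.span k (Set.range g) ^ (N + 1) ≤
      Submodule.span k (Set.range fun i => ∑ j, lam i j • g j) *
        Submodule.span k (Set.range g) ^ N) :
    ∃ a : CoeffRing k ℓ u, MvPolynomial.eval (fun p => lam p.1 p.2) a = 1 ∧
      ∀ x ∈ Submodule.span k (Set.range g) ^ (N + 1), η a * θ x = 0 := by
  let _ : Algebra (CoeffRing k ℓ u) M := η.toAlgebra
  have hsmul (a : CoeffRing k ℓ u) (y : M) : a • y = η a * y := Algebra.smul_def a y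
  set W := Submodule.span k (Set.range g) with hW
  set ev := MvPolynomial.eval (fun p : Fin ℓ × Fin u => lam p.1 p.2) with hev
  set D : Submodule (CoeffRing k ℓ u) M :=
    Submodule.span _ (θ '' (W ^ (N + 1) : Submodule k S))
  have hmem {x} (hx : x ∈ W ^ (N + 1)) : θ x ∈ D := Submodule.subset_span ⟨x, hx, rfl⟩
  have hfg : D.FG := by
    obtain ⟨T, hT⟩ := (Submodule.fg_span (R := k) (Set.finite_range g)).pow (N + 1)
    have : D = Submodule.span _ (θ '' (T : Set S)) := by
      refine le_antisymm (Submodule.span_le.2 ?_) (Submodule.span_mono (Set.image_mono ?_))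
      · rintro _ ⟨x, hx, rfl⟩
        rw [← hW] at hT
        rw [← hT] at hx
        induction hx using Submodule.span_induction with
        | mem x hx => exact Submodule.subset_span ⟨x, hx, rfl⟩
        | zero => rw [map_zero]; exact zero_mem _
        | add x y _ _ hx hy => rw [map_add]; exact add_mem hx hy
        | smul c x _ hx =>
          rw [Algebra.smul_def, map_mul, hθη, ← hsmul]
          exact Submodule.smul_mem _ _ hx
      · rw [← hW] at hT
        rw [← hT]
        exact Submodule.subset_span
    rw [this]
    exact Submodule.fg_span (T.finite_toSet.image θ)
  have hle : D ≤ RingHom.ker ev • D := by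
    refine Submodule.span_le.2 ?_
    rintro _ ⟨x, hx, rfl⟩
    refine Submodule.mul_induction_on (hN hx) (fun v hv y hy => ?_) (fun x y hx hy => ?_)
    · induction hv using Submodule.span_induction with
      | mem v hv =>
        obtain ⟨i, rfl⟩ := hv
        -- Subtracting the generic form, which vanishes in `M`, makes the coefficients vanish
        -- at `lam`.
        have : θ ((∑ j, lam i j • g j) * y) =
            ∑ j, (MvPolynomial.C (lam i j) - MvPolynomial.X (i, j) : CoeffRing k ℓ u) •
              θ (g j * y) := by
          have h0 : ∑ j, η (MvPolynomial.X (i, j)) * θ (g j) * θ y = 0 := by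
            rw [← Finset.sum_mul, hg, zero_mul]
          rw [← sub_zero (θ _), ← h0, map_mul, map_sum, Finset.sum_mul, ← Finset.sum_sub_distrib]
          refine Finset.sum_congr rfl fun j _ => ?_
          rw [hsmul, map_sub, Algebra.smul_def, map_mul, hθη, map_mul]
          ring
        rw [this]
        refine Submodule.sum_mem _ fun j _ => Submodule.smul_mem_smul ?_ (hmem ?_)
        · simp [hev]
        · rw [pow_succ']
          exact Submodule.mul_mem_mul (Submodule.subset_span ⟨j, rfl⟩) hy
      | zero => rw [zero_mul, map_zero]; exact zero_mem _
      | add v v' _ _ hv hv' => rw [add_mul, map_add]; exact add_mem hv hv'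
      | smul c v _ hv =>
        rw [smul_mul_assoc, Algebra.smul_def, map_mul, hθη, ← hsmul]
        exact Submodule.smul_mem _ _ hv
    · rw [map_add]
      exact add_mem hx hy
  obtain ⟨a, ha, haD⟩ :=
    Submodule.exists_sub_one_mem_and_smul_eq_zero_of_fg_of_le_smul (RingHom.ker ev) D hfg hle
  refine ⟨a, ?_, fun x hx => ?_⟩
  · rwa [RingHom.mem_ker, map_sub, map_one, sub_eq_zero] at ha
  · rw [← hsmul]
    exact haD _ (hmem hx)

/-! ### Specialization of the generic ideal -/

section Specialization

variable {𝕜 : Type*} [Field 𝕜] {d u ℓ : ℕ}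

theorem span_range_monomial_one {k A ι : Type*} [Field k] [CommRing A] [Algebra k A] (g : ι → A) :
    Submodule.span k (Set.range fun j => (Polynomial.monomial 1 (g j) : Polynomial A)) =
      (Submodule.span k (Set.range g)).map ((Polynomial.monomial 1).restrictScalars k) := by
  rw [Submodule.map_span, ← Set.range_comp]
  rfl

/-- The inclusion `W ^ (N + 1) ≤ U * W ^ N` is inherited by the spaces `W t` and `U t`. -/
theorem map_span_pow_succ_le {k A ι κ : Type*} [Field k] [CommRing A] [Algebra k A] {g : ι → A}
    {v : κ → A} {N : ℕ}
    (hN : Submodule.span k (Set.range g) ^ (N + 1) ≤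
      Submodule.span k (Set.range v) * Submodule.span k (Set.range g) ^ N) :
    Submodule.span k (Set.range fun j => (Polynomial.monomial 1 (g j) : Polynomial A)) ^ (N + 1) ≤
      Submodule.span k (Set.range fun j => (Polynomial.monomial 1 (v j) : Polynomial A)) *
        Submodule.span k (Set.range fun j => (Polynomial.monomial 1 (g j) : Polynomial A)) ^ N := by
  set μ : ℕ → A →ₗ[k] Polynomial A := fun n => (Polynomial.monomial n).restrictScalars k
  have hmul (U V : Submodule k A) (a b : ℕ) : (U * V).map (μ (a + b)) = U.map (μ a) * V.map (μ b) := by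
    refine le_antisymm ?_ (Submodule.mul_le.2 ?_)
    · rw [Submodule.map_le_iff_le_comap, Submodule.mul_le]
      intro x hx y hy
      have := Submodule.mul_mem_mul (Submodule.mem_map_of_mem (f := μ a) hx)
        (Submodule.mem_map_of_mem (f := μ b) hy)
      rwa [Submodule.mem_comap, show μ (a + b) (x * y) = μ a x * μ b y from
        (Polynomial.monomial_mul_monomial a b x y).symm]
    · rintro _ ⟨x, hx, rfl⟩ _ ⟨y, hy, rfl⟩
      exact ⟨x * y, Submodule.mul_mem_mul hx hy, (Polynomial.monomial_mul_monomial a b x y).symm⟩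
  have hpow (U : Submodule k A) (n : ℕ) : U.map (μ 1) ^ n = (U ^ n).map (μ n) := by
    induction n with
    | zero =>
      rw [pow_zero, pow_zero, Submodule.one_eq_span, Submodule.one_eq_span, Submodule.map_span,
        Set.image_singleton]
      rfl
    | succ n ih => rw [pow_succ, ih, pow_succ, hmul]
  rw [span_range_monomial_one, span_range_monomial_one]
  change (Submodule.span k (Set.range g)).map (μ 1) ^ (N + 1) ≤
    (Submodule.span k (Set.range v)).map (μ 1) * (Submodule.span k (Set.range g)).map (μ 1) ^ N
  rw [hpow, hpow, ← hmul, add_comm 1 N]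
  exact Submodule.map_mono hN

theorem reesDegreeOne_span_pow_succ_le {I : Ideal (MvPolynomial (Fin d) 𝕜)} {f : Fin u → I}
    {lam : Fin ℓ → Fin u → 𝕜} {N : ℕ}
    (hN : Submodule.span 𝕜 (Set.range fun j => (f j : MvPolynomial (Fin d) 𝕜)) ^ (N + 1) ≤
      Submodule.span 𝕜 (Set.range fun i => ∑ j, lam i j • (f j : MvPolynomial (Fin d) 𝕜)) *
        Submodule.span 𝕜 (Set.range fun j => (f j : MvPolynomial (Fin d) 𝕜)) ^ N) :
    Submodule.span 𝕜 (Set.range fun j => reesDegreeOne (f j)) ^ (N + 1) ≤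
      Submodule.span 𝕜 (Set.range fun i => ∑ j, lam i j • reesDegreeOne (f j)) *
        Submodule.span 𝕜 (Set.range fun j => reesDegreeOne (f j)) ^ N := by
  let val := (reesAlgebra I).val.restrictScalars 𝕜
  have hval : Function.Injective val := Subtype.val_injective
  have h := map_span_pow_succ_le hN
  have h1 : Submodule.span 𝕜 (Set.range fun j =>
      (Polynomial.monomial 1 (f j : MvPolynomial (Fin d) 𝕜))) =
      (Submodule.span 𝕜 (Set.range fun j => reesDegreeOne (f j))).map val.toLinearMap := by
    rw [Submodule.map_span, ← Set.range_comp]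
    rfl
  have h2 : Submodule.span 𝕜 (Set.range fun i =>
      (Polynomial.monomial 1 (∑ j, lam i j • (f j : MvPolynomial (Fin d) 𝕜)))) =
      (Submodule.span 𝕜 (Set.range fun i => ∑ j, lam i j • reesDegreeOne (f j))).map
        val.toLinearMap := by
    rw [Submodule.map_span, ← Set.range_comp]
    congr 2
    funext i
    rw [Function.comp_apply, map_sum, map_sum]
    refine Finset.sum_congr rfl fun j _ => ?_
    rw [← Polynomial.smul_monomial, map_smul]
    rfl
  rw [h1, h2, ← Submodule.map_pow, ← Submodule.map_pow, ← Submodule.map_mul] at h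
  exact (Submodule.map_le_map_iff_of_injective hval _ _).1 h

/-- The ideal `𝓐` does not vanish at `lam` if the forms `∑ⱼ lam i j • f j` generate a reduction. -/
theorem exists_mem_nonReductionIdeal_eval_eq_one {I : Ideal (MvPolynomial (Fin d) 𝕜)}
    {f : Fin u → I}
    (hspan : Ideal.span (Set.range fun j => (f j : MvPolynomial (Fin d) 𝕜)) = I)
    {lam : Fin ℓ → Fin u → 𝕜} {N : ℕ}
    (hN : Submodule.span 𝕜 (Set.range fun j => (f j : MvPolynomial (Fin d) 𝕜)) ^ (N + 1) ≤
      Submodule.span 𝕜 (Set.range fun i => ∑ j, lam i j • (f j : MvPolynomial (Fin d) 𝕜)) *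
        Submodule.span 𝕜 (Set.range fun j => (f j : MvPolynomial (Fin d) 𝕜)) ^ N) :
    ∃ a ∈ nonReductionIdeal ℓ f, MvPolynomial.eval (fun p => lam p.1 p.2) a = 1 := by
  let mk := SpecialFiberRing.mk (homMax 𝕜 d) I
  let q := Ideal.Quotient.mk (genericFiberIdeal ℓ f)
  obtain ⟨a, ha, haW⟩ := exists_eval_eq_one_mul_eq_zero
    (q.comp (MvPolynomial.C.comp mk)) (q.comp (MvPolynomial.map (fiberScalars I)))
    (fun c => by
      simp only [RingHom.comp_apply, MvPolynomial.map_C]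
      rfl)
    (fun j => reesDegreeOne (f j))
    (fun i => by
      simp only [RingHom.comp_apply, MvPolynomial.map_X, ← map_mul, ← map_sum]
      exact Ideal.Quotient.eq_zero_iff_mem.2 (Ideal.subset_span ⟨i, rfl⟩))
    lam (reesDegreeOne_span_pow_succ_le hN)
  refine ⟨a, ⟨N + 1, fun y hy => ?_⟩, ha⟩
  have hy' := Ideal.pow_right_mono (Ideal.map_mono (f := MvPolynomial.C)
    (irrelevant_le_span (homMax 𝕜 d) hspan)) (N + 1) hy
  rw [← Ideal.map_pow, Ideal.span, Submodule.span_pow, ← Ideal.span, Ideal.map_span] at hy'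
  refine Submodule.span_induction ?_ ?_ ?_ ?_ hy'
  · rintro _ ⟨z, hz, rfl⟩
    have hr : (Set.range fun j => mk (reesDegreeOne (f j))) =
        mk '' Set.range fun j => reesDegreeOne (f j) := by
      rw [← Set.range_comp]
      rfl
    rw [hr, ← Set.image_pow] at hz
    obtain ⟨x, hx, rfl⟩ := hz
    exact Ideal.Quotient.eq_zero_iff_mem.1 ((map_mul q _ _).trans
      (haW x (Submodule.pow_subset_pow _ (Set.pow_subset_pow_left Submodule.subset_span hx))))
  · rw [mul_zero]; exact zero_mem _
  · intro x y _ _ hx hy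
    rw [mul_add]
    exact add_mem hx hy
  · intro b x _ hx
    rw [smul_eq_mul, mul_left_comm]
    exact Ideal.mul_mem_left _ _ hx

/-- An ideal `K` whose degree `δ` part generates a reduction contains a specialization of the generic
ideal at a point where `h` does not vanish. -/
theorem exists_reduction_eval_ne_zero [Infinite 𝕜] {δ : ℕ} {I : Ideal (MvPolynomial (Fin d) 𝕜)}
    {f : Fin u → I}
    (hspan : Ideal.span (Set.range fun j => (f j : MvPolynomial (Fin d) 𝕜)) = I)
    (hdeg : ∀ j, (f j : MvPolynomial (Fin d) 𝕜).IsHomogeneous δ)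
    (hℓ : analyticSpread I = ℓ) {h : CoeffRing 𝕜 ℓ u}
    (hh : nonReductionIdeal ℓ f = Ideal.span {h}) {K : Ideal (MvPolynomial (Fin d) 𝕜)}
    (hN : ∃ N, Submodule.span 𝕜 (Set.range fun j => (f j : MvPolynomial (Fin d) 𝕜)) ^ (N + 1) ≤
      (K.restrictScalars 𝕜 ⊓
        Submodule.span 𝕜 (Set.range fun j => (f j : MvPolynomial (Fin d) 𝕜))) *
        Submodule.span 𝕜 (Set.range fun j => (f j : MvPolynomial (Fin d) 𝕜)) ^ N) :
    ∃ lam : Fin ℓ → Fin u → 𝕜, (∀ i, ∑ j, lam i j • (f j : MvPolynomial (Fin d) 𝕜) ∈ K) ∧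
      MvPolynomial.eval (fun p => lam p.1 p.2) h ≠ 0 := by
  obtain ⟨N, hN⟩ := hN
  set W := Submodule.span 𝕜 (Set.range fun j => (f j : MvPolynomial (Fin d) 𝕜)) with hW
  set U := K.restrictScalars 𝕜 ⊓ W
  have : FiniteDimensional 𝕜 W := FiniteDimensional.span_of_finite 𝕜 (Set.finite_range _)
  have hUfg : U.FG := by
    have : FiniteDimensional 𝕜 U := Submodule.finiteDimensional_of_le inf_le_right
    exact Module.Finite.iff_fg.1 this
  obtain ⟨m, v, hv⟩ := Submodule.fg_iff_exists_fin_generating_family.1 hUfg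
  have hvU (i) : v i ∈ U := hv ▸ Submodule.subset_span ⟨i, rfl⟩
  rw [← hv] at hN
  obtain ⟨w, hw, N', hN'⟩ := exists_fin_reduction (ℓ := ℓ)
    (fun m hm v hvW => exists_isHomogeneous_aeval_eq_zero hspan hdeg hℓ hm hvW)
    (fun i => (hvU i).2) hN
  rw [hv] at hw
  choose lam hlam using fun i => (Submodule.mem_span_range_iff_exists_fun 𝕜).1 (hw i).2
  obtain rfl : (fun i => ∑ j, lam i j • (f j : MvPolynomial (Fin d) 𝕜)) = w := funext hlam
  refine ⟨lam, fun i => (hw i).1, fun h0 => ?_⟩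
  obtain ⟨a, ha, ha1⟩ := exists_mem_nonReductionIdeal_eval_eq_one hspan hN'
  rw [hh, Ideal.mem_span_singleton] at ha
  obtain ⟨b, rfl⟩ := ha
  rw [map_mul, h0, zero_mul] at ha1
  exact zero_ne_one ha1

/-- Specialization at `z = lam`, where `h` becomes a unit and the generic ideal lands in `K`. -/
theorem mem_of_mul_pow_mem_genericIdeal {f : Fin u → MvPolynomial (Fin d) 𝕜}
    {K : Ideal (MvPolynomial (Fin d) 𝕜)} {lam : Fin ℓ → Fin u → 𝕜}
    (hK : ∀ i, ∑ j, lam i j • f j ∈ K) {h : CoeffRing 𝕜 ℓ u}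
    (hlam : MvPolynomial.eval (fun p => lam p.1 p.2) h ≠ 0) {x : MvPolynomial (Fin d) 𝕜} {n : ℕ}
    (hx : inclR 𝕜 d ℓ u x * MvPolynomial.C h ^ n ∈ genericIdeal ℓ f) : x ∈ K := by
  let sp : MvPolynomial (Fin d) (CoeffRing 𝕜 ℓ u) →+* MvPolynomial (Fin d) 𝕜 :=
    MvPolynomial.map (MvPolynomial.eval fun p => lam p.1 p.2)
  have hsp (y) : sp (inclR 𝕜 d ℓ u y) = y := by
    have hc : (MvPolynomial.eval fun p : Fin ℓ × Fin u => lam p.1 p.2).comp MvPolynomial.C =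
        RingHom.id 𝕜 := by ext; simp
    simp only [sp, inclR]
    rw [MvPolynomial.map_map, hc, MvPolynomial.map_id]
  have hJ : genericIdeal ℓ f ≤ K.comap sp := by
    refine Ideal.span_le.2 ?_
    rintro _ ⟨i, rfl⟩
    rw [SetLike.mem_coe, Ideal.mem_comap, map_sum]
    convert hK i using 2 with j
    rw [map_mul, hsp, MvPolynomial.smul_eq_C_mul]
    simp [sp]
  have := hJ hx
  rw [Ideal.mem_comap, map_mul, hsp, map_pow] at this
  simp only [sp, MvPolynomial.map_C] at this
  have h2 := K.mul_mem_left
    (MvPolynomial.C (MvPolynomial.eval (fun p => lam p.1 p.2) h ^ n)⁻¹) this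
  rw [← map_pow MvPolynomial.C] at h2
  rwa [mul_left_comm, ← MvPolynomial.C_mul, inv_mul_cancel₀ (pow_ne_zero n hlam), map_one,
    mul_one] at h2

end Specialization

theorem theorem5p3 {𝕜 : Type*} [Field 𝕜] [Infinite 𝕜] {d u δ ℓ : ℕ}
    (I : Ideal (MvPolynomial (Fin d) 𝕜)) (hI : I ≠ ⊥)
    (f : Fin u → I)
    (hspan : Ideal.span (Set.range fun j => (f j : MvPolynomial (Fin d) 𝕜)) = I)
    (hmon : ∀ j, ∃ v : Fin d →₀ ℕ, (f j : MvPolynomial (Fin d) 𝕜) = MvPolynomial.monomial v 1)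
    (hdeg : ∀ j, (f j : MvPolynomial (Fin d) 𝕜).IsHomogeneous δ)
    (hℓ : analyticSpread I = ℓ)
    (h : CoeffRing 𝕜 ℓ u) (hh : nonReductionIdeal ℓ f = Ideal.span {h}) :
    (idealSaturation
        (monoIdeal (genericIdeal ℓ fun j => (f j : MvPolynomial (Fin d) 𝕜)))
        (Ideal.span {MvPolynomial.C h})).comap (inclR 𝕜 d ℓ u) ≤ gradedCore I := by
  rintro x ⟨n, hn⟩
  refine Submodule.mem_sInf.2 ?_
  rintro K ⟨hK, hred⟩
  have hmono : monoIdeal (genericIdeal ℓ fun j => (f j : MvPolynomial (Fin d) 𝕜)) ≤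
      genericIdeal ℓ fun j => (f j : MvPolynomial (Fin d) 𝕜) :=
    Ideal.span_le.2 fun p hp => hp.1
  obtain ⟨lam, hlamK, hlam⟩ := exists_reduction_eval_ne_zero hspan hdeg hℓ hh
    (exists_span_pow_succ_le hdeg hK (by rwa [hspan]))
  exact mem_of_mul_pow_mem_genericIdeal hlamK hlam
    (hmono (hn _ (Ideal.pow_mem_pow (Ideal.mem_span_singleton_self _) n)))
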